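/- Let $n \ge 3$ and consider graphs (finite, simple, undirected) on the vertex set $V=\{1,\dots,n\}$; vertices are also called players. For a connected graph $G$ and $u,v\in V$ let $\mathrm{rel}_G(u,v)$ be the number of vertices $w\neq v$ such that every $v$-$w$ path in $G$ visits $u$. Under the \emph{uniform vertex destroyer}, which destroys each vertex of each graph with probability $\frac1n$, the cost of player $v$ in $G$ is $\mathrm{cost}_G(v)=\frac1n\sum_{u\in V}\mathrm{rel}_G(u,v)$ if $G$ is connected, and $\mathrm{cost}_G(v)=\infty$ if $G$ is disconnected. The social cost is $\mathrm{SC}(G)=\sum_{v\in V}\mathrm{cost}_G(v)$. A graph $G$ is a \emph{swap equilibrium} (SE) if no player $a$ can strictly decrease her cost by removing an incident edge $ab$, or by replacing an incident edge $ab$ with a new edge $ac$ (where $c\ne a$ and $ac\notin E(G)$). Let $G$ be a connected graph that is an SE for the uniform vertex destroyer. Then exactly one of the following holds: (i) $G$ is two-connected (that is, $G$ is connected and stays connected when any one vertex is deleted), and then $\mathrm{SC}(G)=2(n-1)$; (ii) $G$ is a star, and then $\mathrm{SC}(G)=3n-5+\frac2n$. In particular $\mathrm{SC}(G)=O(n)$: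 there is an absolute constant $C$ such that $\mathrm{SC}(G)\le C\,n$ for every $n\ge 3$ and every connected SE $G$ on $n$ vertices. -/

import Mathlib

open scoped ENNReal NNReal

namespace DestructionGame

/-- `G + (a,b,c)`: the graph obtained from `G` by removing the edge `ab` and inserting the
edge `ac`. -/
def swap {n : ℕ} (G : SimpleGraph (Fin n)) (a b c : Fin n) : SimpleGraph (Fin n) :=
  G.deleteEdges {s(a, b)} ⊔ SimpleGraph.edge a c

/-- A family of cost functions: each graph `G` on the players `Fin n` and each player `v` are
assigned a cost in `[0, ∞]`. -/
abbrev CostFunction (n : ℕ) := SimpleGraph (Fin n) → Fin n → ℝ≥0∞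

/-- The social cost of `G`: the sum of the costs of all players. -/
noncomputable def socialCost {n : ℕ} (cost : CostFunction n) (G : SimpleGraph (Fin n)) : ℝ≥0∞ :=
  ∑ v, cost G v

/-- `G` is a swap equilibrium: no player can decrease her cost by swapping an incident edge for a
new incident edge, or by removing an incident edge. -/
def IsSwapEquilibrium {n : ℕ} (cost : CostFunction n) (G : SimpleGraph (Fin n)) : Prop :=
  (∀ a b c : Fin n, G.Adj a b → a ≠ c → ¬ G.Adj a c → cost G a ≤ cost (swap G a b c) a) ∧
  (∀ a b : Fin n, G.Adj a b → cost G a ≤ cost (G.deleteEdges {s(a, b)}) a)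

/-- The relevance of the vertex `u` for the player `v`: the number of other players `w` such that
every `v`-`w` path visits `u`. These are the players that `v` can no longer reach when all edges
incident with `u` are removed; in particular the relevance of `v` for herself is `n - 1`. -/
noncomputable def relevance {n : ℕ} (G : SimpleGraph (Fin n)) (u v : Fin n) : ℕ :=
  {w : Fin n | w ≠ v ∧ ∀ p : G.Walk v w, p.IsPath → u ∈ p.support}.ncard

/-- A vertex destroyer associates with each graph a probability measure on its vertices. -/
abbrev VertexDestroyer (n : ℕ) := SimpleGraph (Fin n) → PMF (Fin n)

/-- The uniform vertex destroyer destroys each vertex of each graph with probability `1 / n`. -/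
def VertexDestroyer.IsUniform {n : ℕ} (D : VertexDestroyer n) : Prop :=
  ∀ (G : SimpleGraph (Fin n)) (u : Fin n), D G u = 1 / (n : ℝ≥0∞)

open Classical in
/-- The cost under a vertex destroyer: the expected number of players from which `v` is cut off,
and `∞` if the graph is disconnected. -/
noncomputable def VertexDestroyer.cost {n : ℕ} (D : VertexDestroyer n) : CostFunction n :=
  fun G v => if G.Connected then ∑ u, (relevance G u v : ℝ≥0∞) * D G u else ∞

/-- Two-connected: at least three vertices, connected, and no cutvertex. -/
def IsTwoConnected {n : ℕ} (G : SimpleGraph (Fin n)) : Prop :=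
  3 ≤ n ∧ G.Connected ∧ ∀ v : Fin n, (G.induce {v}ᶜ).Connected

/-- A star: some vertex is adjacent to all others, and there are no further edges. -/
def IsStar {n : ℕ} (G : SimpleGraph (Fin n)) : Prop :=
  ∃ r : Fin n, G = SimpleGraph.starGraph r

end DestructionGame

namespace DestructionGame

open SimpleGraph

variable {n : ℕ}

/-! With all destruction probabilities equal, comparing costs of connected graphs amounts to
comparing sums of relevances. If there is no cutvertex, each player has relevance `n - 1` for
herself and every other vertex has relevance 1, which gives the first value.

Suppose `x` is a cutvertex. A neighbour whose edge to `x` is not a bridge would gain by redirecting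
it across `x`, so all edges at `x` are bridges (`isBridge_of_cutvertex`). If an endpoint of a bridge
has a further neighbour, that neighbour may reattach to the other endpoint; equilibrium then forces
the near side to be strictly larger (`ncard_side_lt`). This cannot hold at both endpoints, so one of
them is a leaf (`leaf_of_isBridge`). Since `x` has at least two neighbours, they are all leaves and
the graph is a star. -/

/-- There is a `v`-`w` walk in `G` that does not visit `u`. -/
def JoinedAvoiding (G : SimpleGraph (Fin n)) (u v w : Fin n) : Prop :=
  ∃ p : G.Walk v w, u ∉ p.support

namespace JoinedAvoiding

variable {G H : SimpleGraph (Fin n)} {u v w x : Fin n}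

lemma refl (G : SimpleGraph (Fin n)) (h : u ≠ v) : JoinedAvoiding G u v v :=
  ⟨.nil, by simpa using h⟩

lemma symm (h : JoinedAvoiding G u v w) : JoinedAvoiding G u w v := by
  obtain ⟨p, hp⟩ := h
  exact ⟨p.reverse, by simpa using hp⟩

lemma trans (h : JoinedAvoiding G u v w) (h' : JoinedAvoiding G u w x) :
    JoinedAvoiding G u v x := by
  obtain ⟨p, hp⟩ := h
  obtain ⟨q, hq⟩ := h'
  exact ⟨p.append q, by simp [Walk.mem_support_append_iff, hp, hq]⟩

lemma of_adj (h : G.Adj v w) (hv : u ≠ v) (hw : u ≠ w) : JoinedAvoiding G u v w :=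
  ⟨h.toWalk, by simp [hv, hw]⟩

lemma ne_left (h : JoinedAvoiding G u v w) : u ≠ v := by
  rintro rfl
  obtain ⟨p, hp⟩ := h
  exact hp p.start_mem_support

lemma ne_right (h : JoinedAvoiding G u v w) : u ≠ w := h.symm.ne_left

lemma mono (hGH : G ≤ H) (h : JoinedAvoiding G u v w) : JoinedAvoiding H u v w := by
  obtain ⟨p, hp⟩ := h
  exact ⟨p.mapLe hGH, by simpa using hp⟩

lemma exists_isPath (h : JoinedAvoiding G u v w) :
    ∃ p : G.Walk v w, p.IsPath ∧ u ∉ p.support := by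
  obtain ⟨p, hp⟩ := h
  exact ⟨p.bypass, p.bypass_isPath, fun hu => hp (p.support_bypass_subset_support hu)⟩

end JoinedAvoiding

/-! ### Relevance as the size of a cut-off set -/

section Relevance

variable {G H : SimpleGraph (Fin n)} {u v w : Fin n}

/-- A path meets its endpoint only at the end, so its initial segment up to an earlier vertex misses
it. -/
lemma joinedAvoiding_of_mem_path {p : G.Walk v w} (hp : p.IsPath) (hu : u ∈ p.support)
    (h : u ≠ w) : JoinedAvoiding G w v u :=
  ⟨p.takeUntil u hu, Walk.endpoint_notMem_support_takeUntil hp hu h.symm⟩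

/-- The players from which `v` is cut off when `u` is destroyed. -/
def cutOff (G : SimpleGraph (Fin n)) (u v : Fin n) : Set (Fin n) :=
  {w | w ≠ v ∧ ¬ JoinedAvoiding G u v w}

lemma relevance_eq_ncard_cutOff (G : SimpleGraph (Fin n)) (u v : Fin n) :
    relevance G u v = (cutOff G u v).ncard := by
  unfold relevance cutOff
  congr 1
  ext w
  simp only [Set.mem_ofPred_eq, and_congr_right_iff]
  intro _
  constructor
  · intro h h'
    obtain ⟨p, hp, hu⟩ := h'.exists_isPath
    exact hu (h p hp)
  · intro h p _
    by_contra hu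
    exact h ⟨p, hu⟩

lemma ncard_compl_singleton (v : Fin n) : ({v}ᶜ : Set (Fin n)).ncard = n - 1 := by
  rw [Set.ncard_compl]
  simp

lemma relevance_self (G : SimpleGraph (Fin n)) (v : Fin n) : relevance G v v = n - 1 := by
  rw [relevance_eq_ncard_cutOff, ← ncard_compl_singleton v]
  congr 1
  ext w
  simp only [cutOff, Set.mem_ofPred_eq, Set.mem_compl_iff, Set.mem_singleton_iff,
    and_iff_left_iff_imp]
  exact fun _ h => h.ne_left rfl

lemma relevance_eq_one (huv : u ≠ v) (h : ∀ w, w ≠ u → JoinedAvoiding G u v w) :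
    relevance G u v = 1 := by
  rw [relevance_eq_ncard_cutOff, Set.ncard_eq_one]
  refine ⟨u, Set.ext fun w => ?_⟩
  simp only [cutOff, Set.mem_ofPred_eq, Set.mem_singleton_iff]
  constructor
  · rintro ⟨_, hw⟩
    by_contra hne
    exact hw (h w hne)
  · rintro rfl
    exact ⟨huv, fun h => h.ne_right rfl⟩

end Relevance

/-! ### Reducing costs to sums of natural numbers -/

section Cost

variable {G H : SimpleGraph (Fin n)} {D : VertexDestroyer n} {u v : Fin n}

lemma cost_of_connected (hD : D.IsUniform) (hG : G.Connected) (v : Fin n) :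
    D.cost G v = ((∑ u, relevance G u v : ℕ) : ℝ≥0∞) * (1 / (n : ℝ≥0∞)) := by
  simp only [VertexDestroyer.cost, if_pos hG]
  push_cast
  rw [Finset.sum_mul]
  exact Finset.sum_congr rfl fun u _ => by rw [hD G u]

lemma sum_relevance_le_of_cost_le (hD : D.IsUniform) (hG : G.Connected) (hH : H.Connected)
    (h : D.cost G v ≤ D.cost H v) : ∑ u, relevance G u v ≤ ∑ u, relevance H u v := by
  rw [cost_of_connected hD hG, cost_of_connected hD hH] at h
  have hn : (n : ℝ≥0∞) ≠ 0 := by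
    have := v.pos
    exact_mod_cast this.ne'
  have h0 : (1 / (n : ℝ≥0∞)) ≠ 0 := by simp
  have ht : (1 / (n : ℝ≥0∞)) ≠ ⊤ := by simpa using hn
  rw [ENNReal.mul_le_mul_iff_left h0 ht] at h
  exact_mod_cast h

lemma socialCost_of_connected (hD : D.IsUniform) (hG : G.Connected) :
    socialCost D.cost G = ENNReal.ofReal (((∑ v, ∑ u, relevance G u v : ℕ) : ℝ) / n) := by
  have hn : 0 < (n : ℝ) := by
    have := hG.nonempty.some.pos
    exact_mod_cast this
  rw [ENNReal.ofReal_div_of_pos hn, ENNReal.ofReal_natCast, ENNReal.ofReal_natCast,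
    div_eq_mul_one_div]
  simp only [socialCost, cost_of_connected hD hG]
  rw [← Finset.sum_mul]
  push_cast
  rfl

end Cost

/-! ### Connectivity after a swap -/

section Swap

variable {G : SimpleGraph (Fin n)} {a b c u v w : Fin n}

lemma swap_adj_new (hac : a ≠ c) : (swap G a b c).Adj a c := by
  simp [swap, SimpleGraph.edge_adj, hac]

lemma deleteEdges_le_swap : G.deleteEdges {s(a, b)} ≤ swap G a b c := le_sup_left

lemma joinedAvoiding_deleteEdges {p : G.Walk v w} (hp : s(a, b) ∉ p.edges)
    (hu : u ∉ p.support) : JoinedAvoiding (G.deleteEdges {s(a, b)}) u v w :=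
  ⟨p.toDeleteEdge s(a, b) hp, by simpa using hu⟩

/-- A path from `a` can use the deleted edge `ab` only as its first step; dropping that step leaves
a walk from `b`. -/
lemma joinedAvoiding_swap_or (h : JoinedAvoiding G u a w) :
    JoinedAvoiding (swap G a b c) u a w ∨ JoinedAvoiding (swap G a b c) u b w := by
  obtain ⟨p, hp, hu⟩ := h.exists_isPath
  cases p with
  | nil => exact .inl (.refl _ (by simpa using hu))
  | @cons _ x _ hax q =>
    rw [Walk.cons_isPath_iff] at hp
    rw [Walk.support_cons, List.mem_cons, not_or] at hu
    have hq : s(a, b) ∉ q.edges := fun h => hp.2 (q.fst_mem_support_of_mem_edges h)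
    have hj : JoinedAvoiding (swap G a b c) u x w :=
      (joinedAvoiding_deleteEdges hq hu.2).mono deleteEdges_le_swap
    by_cases hxb : x = b
    · exact .inr (hxb ▸ hj)
    · refine .inl (JoinedAvoiding.trans (.of_adj ?_ hu.1 hj.ne_left) hj)
      apply deleteEdges_le_swap
      simp only [deleteEdges_adj, Set.mem_singleton_iff, hax, true_and]
      intro h
      rw [Sym2.congr_right] at h
      exact hxb h

lemma JoinedAvoiding.swap (hab : JoinedAvoiding (swap G a b c) u a b)
    (h : JoinedAvoiding G u a w) : JoinedAvoiding (DestructionGame.swap G a b c) u a w :=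
  (joinedAvoiding_swap_or h).elim id hab.trans

lemma connected_swap (hG : G.Connected) (hab : (swap G a b c).Reachable a b) :
    (swap G a b c).Connected := by
  have := hG.nonempty
  refine ⟨fun v w => ?_⟩
  obtain ⟨p⟩ := hG.preconnected v w
  induction p with
  | nil => exact .rfl
  | @cons x y _ hxy _ ih =>
    refine Reachable.trans ?_ ih
    by_cases he : s(x, y) = s(a, b)
    · rcases Sym2.eq_iff.1 he with ⟨rfl, rfl⟩ | ⟨rfl, rfl⟩
      · exact hab
      · exact hab.symm
    · refine Adj.reachable (deleteEdges_le_swap ?_)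
      simpa [deleteEdges_adj, hxy] using he

end Swap

/-! ### Cutvertices and bridges in an equilibrium -/

section Equilibrium

variable {G : SimpleGraph (Fin n)} {D : VertexDestroyer n} {a b c v x : Fin n}

/-- Replacing a non-bridge to a cutvertex by an edge across the cutvertex is an improvement. -/
lemma isBridge_of_cutvertex (hD : D.IsUniform) (hG : G.Connected)
    (hSE : IsSwapEquilibrium D.cost G) (hab : G.Adj a b) (hcb : c ≠ b)
    (hc : ¬ JoinedAvoiding G b a c) : G.IsBridge s(a, b) := by
  by_contra hbr
  rw [isBridge_iff, not_not] at hbr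
  have hba : b ≠ a := hab.ne'
  have hac : a ≠ c := by
    rintro rfl
    exact hc (.refl _ hba)
  have hnadj : ¬ G.Adj a c := fun h => hc (.of_adj h hba hcb.symm)
  have hcon := connected_swap (c := c) hG (hbr.mono deleteEdges_le_swap)
  have hle := sum_relevance_le_of_cost_le hD hG hcon (hSE.1 a b c hab hac hnadj)
  -- Otherwise `u` lies on an `a`-`b` path without the edge `ab` and on a `c`-`b` path; their
  -- initial segments up to `u` join `a` to `c` outside `b`.
  have key : ∀ u, u ≠ a → u ≠ b → JoinedAvoiding (swap G a b c) u a b := by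
    intro u hua hub
    by_contra hno
    obtain ⟨p, hp⟩ := hbr.exists_isPath
    obtain ⟨q, hq⟩ := hG.exists_isPath c b
    have hup : u ∈ p.support := by
      by_contra h
      exact hno (JoinedAvoiding.mono deleteEdges_le_swap ⟨p, h⟩)
    have haq : s(a, b) ∉ q.edges := fun h => hc
      (joinedAvoiding_of_mem_path hq (q.fst_mem_support_of_mem_edges h) hba.symm).symm
    have huq : u ∈ q.support := by
      by_contra h
      have h1 : JoinedAvoiding (swap G a b c) u c b :=
        (joinedAvoiding_deleteEdges haq h).mono deleteEdges_le_swap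
      exact hno (.trans (.of_adj (swap_adj_new hac) hua h1.ne_left) h1)
    exact hc (((joinedAvoiding_of_mem_path hp hup hub).mono (deleteEdges_le _)).trans
      (joinedAvoiding_of_mem_path hq huq hub).symm)
  have hsub : ∀ u, cutOff (swap G a b c) u a ⊆ cutOff G u a := by
    rintro u w ⟨hwa, hw⟩
    refine ⟨hwa, fun h => hw ?_⟩
    by_cases hub : u = b
    · subst hub
      exact (joinedAvoiding_swap_or h).resolve_right fun h => h.ne_left rfl
    · exact (key u h.ne_left hub).swap h
  -- The gain is strict at `b`: when `b` is destroyed, the new edge still reaches `c`.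
  have hlt : ∑ u, relevance (swap G a b c) u a < ∑ u, relevance G u a := by
    simp only [relevance_eq_ncard_cutOff]
    refine Finset.sum_lt_sum (fun u _ => Set.ncard_le_ncard (hsub u)) ⟨b, Finset.mem_univ _, ?_⟩
    refine Set.ncard_lt_ncard ⟨hsub b, fun h => ?_⟩
    exact (h (show c ∈ cutOff G b a from ⟨hac.symm, hc⟩)).2
      (.of_adj (swap_adj_new hac) hba hcb.symm)
  omega

/-- The vertices on the side of `a` when the edge `ab` is deleted. -/
def side (G : SimpleGraph (Fin n)) (a b : Fin n) : Set (Fin n) :=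
  {z | (G.deleteEdges {s(a, b)}).Reachable a z}

/-- If the endpoint `a` of a bridge `ab` has another neighbour `v`, then `v` does not gain from
replacing `va` by `vb`. -/
lemma ncard_side_lt (hD : D.IsUniform) (hG : G.Connected)
    (hSE : IsSwapEquilibrium D.cost G) (hab : G.Adj a b) (hbr : G.IsBridge s(a, b))
    (hva : G.Adj v a) (hvb : v ≠ b) : (side G b a).ncard < (side G a b).ncard := by
  rw [isBridge_iff] at hbr
  have hsym : side G b a = {z | (G.deleteEdges {s(a, b)}).Reachable b z} := by
    rw [side, Sym2.eq_swap]
  have hva' : (G.deleteEdges {s(a, b)}).Adj a v := by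
    simp only [deleteEdges_adj, hva.symm, true_and, Set.mem_singleton_iff, Sym2.congr_right]
    exact hvb
  have hvX : v ∈ side G a b := hva'.reachable
  have hnadj : ¬ G.Adj v b := by
    intro h
    refine hbr (hva'.reachable.trans (Adj.reachable ?_))
    simp only [deleteEdges_adj, h, true_and, Set.mem_singleton_iff, Sym2.congr_left]
    exact hva.ne
  have hvb' : (swap G v a b).Adj v b := swap_adj_new hvb
  have hab' : (swap G v a b).Adj a b := by
    apply deleteEdges_le_swap
    simp only [deleteEdges_adj, hab, true_and, Set.mem_singleton_iff, Sym2.eq_iff]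
    rintro (⟨rfl, -⟩ | ⟨-, rfl⟩)
    · exact hva.ne rfl
    · exact hvb rfl
  have hcon := connected_swap (a := v) (b := a) (c := b) hG
    (hvb'.reachable.trans hab'.symm.reachable)
  have hle := sum_relevance_le_of_cost_le hD hG hcon (hSE.1 v a b hva hvb hnadj)
  have cross : ∀ z, z ∈ side G b a → ∀ p : G.Walk v z, s(a, b) ∈ p.edges := by
    intro z hz p
    by_contra hp
    rw [hsym] at hz
    exact hbr (hva'.reachable.trans (Reachable.trans ⟨p.toDeleteEdge s(a, b) hp⟩ hz.symm))
  have cover : ∀ z, z ∉ side G a b → z ∈ side G b a := by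
    intro z hz
    rw [hsym]
    obtain ⟨p, hp⟩ := hG.exists_isPath z b
    by_cases he : s(a, b) ∈ p.edges
    · exfalso
      have ha := p.fst_mem_support_of_mem_edges he
      have hb := Walk.endpoint_notMem_support_takeUntil hp ha hab.ne'
      refine hz (Reachable.symm ⟨(p.takeUntil a ha).toDeleteEdge s(a, b) fun h => hb ?_⟩)
      exact Walk.snd_mem_support_of_mem_edges _ h
    · exact Reachable.symm ⟨p.toDeleteEdge s(a, b) he⟩
  -- When a vertex other than `a` and `b` is destroyed, the detour `v`-`b`-`a` replaces the lost
  -- edge `va`.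
  have hsub : ∀ u, u ≠ b → cutOff (swap G v a b) u v ⊆ cutOff G u v := by
    rintro u hub w ⟨hwv, hw⟩
    refine ⟨hwv, fun h => hw ?_⟩
    by_cases hua : u = a
    · subst hua
      exact (joinedAvoiding_swap_or h).resolve_right fun h => h.ne_left rfl
    · exact JoinedAvoiding.swap ((JoinedAvoiding.of_adj hvb' h.ne_left hub).trans
        (.of_adj hab'.symm hub hua)) h
  -- Destroying `b` can newly cut `v` off only from the side of `a`; the `+ 1` is `v` herself, who
  -- lies there but is not counted.
  have hb : relevance (swap G v a b) b v + 1 ≤ relevance G b v + (side G a b).ncard := by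
    have h1 : cutOff (swap G v a b) b v ⊆ cutOff G b v ∪ (side G a b \ {v}) := by
      rintro w ⟨hwv, hw⟩
      by_cases hwX : w ∈ side G a b
      · exact .inr ⟨hwX, hwv⟩
      · refine .inl ⟨hwv, fun ⟨p, hp⟩ => hp ?_⟩
        exact p.snd_mem_support_of_mem_edges (cross w (cover w hwX) p)
    have h2 := (Set.ncard_le_ncard h1).trans (Set.ncard_union_le _ _)
    have h3 := Set.ncard_sdiff_singleton_add_one hvX
    rw [relevance_eq_ncard_cutOff, relevance_eq_ncard_cutOff]
    omega
  -- Destroying `a` used to cut `v` off from the whole side of `b`; the new edge `vb` now reaches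
  -- all of it.
  have ha : relevance (swap G v a b) a v + (side G b a).ncard ≤ relevance G a v := by
    rw [relevance_eq_ncard_cutOff, relevance_eq_ncard_cutOff, ← Set.ncard_union_eq]
    · refine Set.ncard_le_ncard (Set.union_subset (hsub a hab.ne) fun z hz => ⟨?_, ?_⟩)
      · rintro rfl
        rw [hsym] at hz
        exact hbr (hvX.trans hz.symm)
      · rintro ⟨p, hp⟩
        exact hp (p.fst_mem_support_of_mem_edges (cross z hz p))
    · rw [Set.disjoint_left]
      rintro z ⟨_, hz⟩ hzY
      rw [hsym] at hzY
      obtain ⟨p, hp⟩ := hzY.exists_isPath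
      have hap : a ∉ p.support := fun h => hbr (Reachable.symm ⟨p.takeUntil a h⟩)
      have hvp : v ∉ p.support := fun h =>
        hbr (hvX.trans (Reachable.symm ⟨p.takeUntil v h⟩))
      have h1 : JoinedAvoiding G a b z :=
        JoinedAvoiding.mono (deleteEdges_le _) ⟨p, hap⟩
      have h2 : JoinedAvoiding (swap G v a b) a b z := by
        refine (joinedAvoiding_deleteEdges (p := p.mapLe (deleteEdges_le _)) (fun h => hvp ?_)
          (by simpa using hap)).mono deleteEdges_le_swap
        simpa using Walk.fst_mem_support_of_mem_edges _ h
      exact hz (.trans (.of_adj hvb' hva.ne' hab.ne) h2)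
  have hrest : ∑ u ∈ Finset.univ \ {a, b}, relevance (swap G v a b) u v
      ≤ ∑ u ∈ Finset.univ \ {a, b}, relevance G u v := by
    refine Finset.sum_le_sum fun u hu => ?_
    simp only [Finset.mem_sdiff, Finset.mem_univ, Finset.mem_insert, Finset.mem_singleton,
      true_and, not_or] at hu
    rw [relevance_eq_ncard_cutOff, relevance_eq_ncard_cutOff]
    exact Set.ncard_le_ncard (hsub u hu.2)
  rw [← Finset.sum_sdiff (Finset.subset_univ {a, b}), Finset.sum_pair hab.ne,
    ← Finset.sum_sdiff (Finset.subset_univ {a, b}), Finset.sum_pair hab.ne] at hle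
  omega

/-- One endpoint of a bridge is a leaf. -/
lemma leaf_of_isBridge (hD : D.IsUniform) (hG : G.Connected)
    (hSE : IsSwapEquilibrium D.cost G) (hab : G.Adj a b) (hbr : G.IsBridge s(a, b)) :
    (∀ v, G.Adj v a → v = b) ∨ ∀ w, G.Adj w b → w = a := by
  by_contra! h
  obtain ⟨⟨v, hva, hvb⟩, w, hwb, hwa⟩ := h
  have h1 := ncard_side_lt hD hG hSE hab hbr hva hvb
  have h2 := ncard_side_lt hD hG hSE hab.symm (Sym2.eq_swap (a := a) ▸ hbr) hwb hwa
  omega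

/-- Every edge at `x` is a bridge and `x` is not a leaf, so each neighbour of `x` is one;
connectedness leaves no room for other vertices. -/
lemma isStar_of_cutvertex (hD : D.IsUniform) (hG : G.Connected)
    (hSE : IsSwapEquilibrium D.cost G) (hax : a ≠ x) (hcx : c ≠ x)
    (hac : ¬ JoinedAvoiding G x a c) : IsStar G := by
  have hbr : ∀ y, G.Adj y x → G.IsBridge s(y, x) := by
    intro y hy
    by_cases h : JoinedAvoiding G x y a
    · exact isBridge_of_cutvertex hD hG hSE hy hcx fun h' => hac (h.symm.trans h')
    · exact isBridge_of_cutvertex hD hG hSE hy hax h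
  -- `a` and `c` are joined to `x` through different neighbours
  have hnb : ∀ z, z ≠ x → ∃ y, G.Adj y x ∧ JoinedAvoiding G x z y := by
    intro z hz
    obtain ⟨p, hp⟩ := hG.exists_isPath x z
    cases p with
    | nil => exact absurd rfl hz
    | @cons _ y _ hxy q =>
      rw [Walk.cons_isPath_iff] at hp
      exact ⟨y, hxy.symm, JoinedAvoiding.symm ⟨q, hp.2⟩⟩
  obtain ⟨ya, hya, ha⟩ := hnb a hax
  obtain ⟨yc, hyc, hc⟩ := hnb c hcx
  have hne : ya ≠ yc := by
    rintro rfl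
    exact hac (ha.trans hc.symm)
  have hleaf : ∀ y, G.Adj y x → ∀ v, G.Adj v y → v = x := by
    intro y hy
    refine (leaf_of_isBridge hD hG hSE hy (hbr y hy)).resolve_right fun h => hne ?_
    rw [h ya hya, h yc hyc]
  have hall : ∀ z, z ≠ x → G.Adj z x := by
    intro z hz
    obtain ⟨y, hy, p, hp⟩ := hnb z hz
    -- A nontrivial walk from the leaf `y` must step to `x`, which is avoided; hence `z = y`.
    cases h : p.reverse with
    | nil => exact hy
    | cons hyz q =>
      have h1 := hleaf y hy _ hyz.symm
      subst h1
      refine absurd ?_ hp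
      rw [← List.mem_reverse, ← Walk.support_reverse, h]
      simp
  refine ⟨x, ?_⟩
  ext v w
  rw [starGraph_adj]
  constructor
  · intro h
    refine ⟨h.ne, or_iff_not_imp_right.2 fun hw => hleaf w (hall w hw) v h⟩
  · rintro ⟨hvw, rfl | rfl⟩
    · exact (hall w hvw.symm).symm
    · exact hall v hvw

end Equilibrium

/-! ### The dichotomy and the two social costs -/

section Structure

variable {G : SimpleGraph (Fin n)} {D : VertexDestroyer n}

lemma induce_compl_reachable_iff {x a c : Fin n} (ha : a ∈ ({x}ᶜ : Set (Fin n)))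
    (hc : c ∈ ({x}ᶜ : Set (Fin n))) :
    (G.induce {x}ᶜ).Reachable ⟨a, ha⟩ ⟨c, hc⟩ ↔ JoinedAvoiding G x a c := by
  constructor
  · rintro ⟨p⟩
    have h : x ∉ (p.map (Embedding.induce ({x}ᶜ : Set (Fin n))).toHom).support := by
      rw [Walk.support_map, List.mem_map]
      rintro ⟨⟨z, hz⟩, -, hzx⟩
      exact hz hzx
    exact ⟨_, h⟩
  · rintro ⟨p, hp⟩
    exact ⟨p.induce _ fun z hz => by rintro rfl; exact hp hz⟩

lemma isTwoConnected_iff (hn : 3 ≤ n) (hG : G.Connected) :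
    IsTwoConnected G ↔ ∀ x a c, a ≠ x → c ≠ x → JoinedAvoiding G x a c := by
  constructor
  · rintro ⟨-, -, h⟩ x a c ha hc
    exact (induce_compl_reachable_iff ha hc).1 ((h x).preconnected _ _)
  · intro h
    refine ⟨hn, hG, fun x => ?_⟩
    have : Nontrivial (Fin n) := Fin.nontrivial_iff_two_le.2 (by omega)
    obtain ⟨y, hy⟩ := exists_ne x
    have : Nonempty ({x}ᶜ : Set (Fin n)) := ⟨⟨y, hy⟩⟩
    exact ⟨fun ⟨a, ha⟩ ⟨c, hc⟩ => (induce_compl_reachable_iff ha hc).2 (h x a c ha hc)⟩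

lemma not_joinedAvoiding_starGraph {r a c : Fin n} (hac : a ≠ c) :
    ¬ JoinedAvoiding (starGraph r) r a c := by
  rintro ⟨p, hp⟩
  cases p with
  | nil => exact hac rfl
  | cons h q =>
    rw [starGraph_adj] at h
    simp only [Walk.support_cons, List.mem_cons, not_or] at hp
    rcases h.2 with rfl | rfl
    · exact hp.1 rfl
    · exact hp.2 q.start_mem_support

lemma not_isTwoConnected_of_isStar (hn : 3 ≤ n) (hG : G.Connected) (h : IsStar G) :
    ¬ IsTwoConnected G := by
  obtain ⟨r, rfl⟩ := h
  rw [isTwoConnected_iff hn hG]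
  intro h
  obtain ⟨a, c, har, hcr, hac⟩ : ∃ a c : Fin n, a ≠ r ∧ c ≠ r ∧ a ≠ c := by
    have : 1 < ({r}ᶜ : Set (Fin n)).ncard := by
      rw [ncard_compl_singleton]
      omega
    obtain ⟨a, ha, c, hc, hac⟩ := (Set.one_lt_ncard).1 this
    exact ⟨a, c, ha, hc, hac⟩
  exact not_joinedAvoiding_starGraph hac (h r a c har hcr)

lemma xor_isTwoConnected_isStar (hn : 3 ≤ n) (hD : D.IsUniform) (hG : G.Connected)
    (hSE : IsSwapEquilibrium D.cost G) : Xor (IsTwoConnected G) (IsStar G) := by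
  by_cases h : IsTwoConnected G
  · exact .inl ⟨h, fun hs => not_isTwoConnected_of_isStar hn hG hs h⟩
  · refine .inr ⟨?_, h⟩
    rw [isTwoConnected_iff hn hG] at h
    push Not at h
    obtain ⟨x, a, c, ha, hc, hac⟩ := h
    exact isStar_of_cutvertex hD hG hSE ha hc hac

lemma sum_relevance_of_eq_one (v : Fin n) (h : ∀ u, u ≠ v → relevance G u v = 1) :
    ∑ u, relevance G u v = 2 * (n - 1) := by
  rw [← Finset.add_sum_erase _ _ (Finset.mem_univ v), relevance_self,
    Finset.sum_congr rfl fun u hu => h u (Finset.ne_of_mem_erase hu)]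
  simp [two_mul]

lemma socialCost_of_isTwoConnected (hD : D.IsUniform) (h : IsTwoConnected G) :
    socialCost D.cost G = ENNReal.ofReal (2 * ((n : ℝ) - 1)) := by
  have hn := h.1
  have hG := h.2.1
  rw [isTwoConnected_iff hn hG] at h
  have hsum : ∀ v, ∑ u, relevance G u v = 2 * (n - 1) := fun v =>
    sum_relevance_of_eq_one v fun u hu => relevance_eq_one hu fun w hw => h u v w hu.symm hw
  rw [socialCost_of_connected hD hG]
  simp only [hsum, Finset.sum_const, Finset.card_univ, Fintype.card_fin, smul_eq_mul]
  have : (n : ℝ) ≠ 0 := by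
    have : n ≠ 0 := by omega
    exact_mod_cast this
  push_cast [Nat.cast_sub (show 1 ≤ n by omega)]
  rw [mul_div_cancel_left₀ _ this]

lemma joinedAvoiding_starGraph {r u v w : Fin n} (hr : u ≠ r) (hv : u ≠ v) (hw : u ≠ w) :
    JoinedAvoiding (starGraph r) u v w := by
  have key : ∀ z, u ≠ z → JoinedAvoiding (starGraph r) u r z := by
    intro z hz
    by_cases h : r = z
    · exact h ▸ .refl _ hr
    · exact .of_adj (starGraph_center_adj h) hr hz
  exact (key v hv).symm.trans (key w hw)

lemma relevance_starGraph_center {r v : Fin n} :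
    relevance (starGraph r) r v = n - 1 := by
  rw [relevance_eq_ncard_cutOff, ← ncard_compl_singleton v]
  congr 1
  ext w
  simp only [cutOff, Set.mem_ofPred_eq, Set.mem_compl_iff, Set.mem_singleton_iff,
    and_iff_left_iff_imp]
  exact fun hw => not_joinedAvoiding_starGraph (Ne.symm hw)

lemma socialCost_of_isStar (hn : 3 ≤ n) (hD : D.IsUniform) (h : IsStar G) :
    socialCost D.cost G = ENNReal.ofReal (3 * (n : ℝ) - 5 + 2 / (n : ℝ)) := by
  obtain ⟨r, rfl⟩ := h
  have hone : ∀ u v, u ≠ r → u ≠ v → relevance (starGraph r) u v = 1 := fun u v hr hv =>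
    relevance_eq_one hv fun w hw => joinedAvoiding_starGraph hr hv hw.symm
  have hcenter : ∑ u, relevance (starGraph r) u r = 2 * (n - 1) :=
    sum_relevance_of_eq_one r fun u hu => hone u r hu hu
  -- The leaf herself and the centre contribute `n - 1` each, the other `n - 2` leaves 1 each.
  have hleaf : ∀ v, v ≠ r → ∑ u, relevance (starGraph r) u v = 3 * n - 4 := by
    intro v hv
    rw [← Finset.add_sum_erase _ _ (Finset.mem_univ v), relevance_self,
      ← Finset.add_sum_erase _ _ (Finset.mem_erase.2 ⟨hv.symm, Finset.mem_univ r⟩),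
      relevance_starGraph_center, Finset.sum_congr rfl fun u hu => hone u v
        (Finset.ne_of_mem_erase hu) (Finset.ne_of_mem_erase (Finset.mem_of_mem_erase hu))]
    rw [Finset.sum_const, Finset.card_erase_of_mem
      (Finset.mem_erase.2 ⟨hv.symm, Finset.mem_univ r⟩),
      Finset.card_erase_of_mem (Finset.mem_univ v), Finset.card_univ, Fintype.card_fin,
      smul_eq_mul]
    omega
  rw [socialCost_of_connected hD (connected_starGraph r),
    ← Finset.add_sum_erase _ _ (Finset.mem_univ r), hcenter,
    Finset.sum_congr rfl fun v hv => hleaf v (Finset.ne_of_mem_erase hv)]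
  rw [Finset.sum_const, Finset.card_erase_of_mem (Finset.mem_univ r), Finset.card_univ,
    Fintype.card_fin, smul_eq_mul]
  have : (n : ℝ) ≠ 0 := by
    have : n ≠ 0 := by omega
    exact_mod_cast this
  congr 1
  push_cast [Nat.cast_sub (show 1 ≤ n by omega), Nat.cast_sub (show 4 ≤ 3 * n by omega)]
  field_simp
  ring

lemma socialCost_le (hn : 3 ≤ n) (hD : D.IsUniform) (hG : G.Connected)
    (hSE : IsSwapEquilibrium D.cost G) : socialCost D.cost G ≤ ((3 : ℝ≥0) : ℝ≥0∞) * (n : ℝ≥0∞) := by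
  have hn' : (3 : ℝ) ≤ n := by exact_mod_cast hn
  have hr : ((3 : ℝ≥0) : ℝ≥0∞) * (n : ℝ≥0∞) = ENNReal.ofReal (3 * n) := by
    rw [ENNReal.ofReal_mul (by norm_num), ENNReal.ofReal_natCast]
    norm_num
  rw [hr]
  rcases xor_isTwoConnected_isStar hn hD hG hSE with ⟨h, -⟩ | ⟨h, -⟩
  · rw [socialCost_of_isTwoConnected hD h]
    exact ENNReal.ofReal_le_ofReal (by linarith)
  · rw [socialCost_of_isStar hn hD h]
    have h2 : 2 / (n : ℝ) ≤ 1 := by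
      rw [div_le_one (by linarith)]
      linarith
    exact ENNReal.ofReal_le_ofReal (by linarith)

end Structure

end DestructionGame

theorem mainTheorem5 :
    (∀ (n : ℕ) (_hn : 3 ≤ n)
        (D : DestructionGame.VertexDestroyer n) (_hD : DestructionGame.VertexDestroyer.IsUniform D)
        (G : SimpleGraph (Fin n)) (_hG : G.Connected)
        (_hSE : DestructionGame.IsSwapEquilibrium (DestructionGame.VertexDestroyer.cost D) G),
        Xor (DestructionGame.IsTwoConnected G) (DestructionGame.IsStar G) ∧
        (DestructionGame.IsTwoConnected G →
          DestructionGame.socialCost (DestructionGame.VertexDestroyer.cost D) G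
            = ENNReal.ofReal (2 * ((n : ℝ) - 1))) ∧
        (DestructionGame.IsStar G →
          DestructionGame.socialCost (DestructionGame.VertexDestroyer.cost D) G
            = ENNReal.ofReal (3 * (n : ℝ) - 5 + 2 / (n : ℝ)))) ∧
    (∃ C : ℝ≥0, ∀ (n : ℕ) (_hn : 3 ≤ n)
        (D : DestructionGame.VertexDestroyer n) (_hD : DestructionGame.VertexDestroyer.IsUniform D)
        (G : SimpleGraph (Fin n)) (_hG : G.Connected)
        (_hSE : DestructionGame.IsSwapEquilibrium (DestructionGame.VertexDestroyer.cost D) G),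
        DestructionGame.socialCost (DestructionGame.VertexDestroyer.cost D) G
          ≤ (C : ℝ≥0∞) * (n : ℝ≥0∞)) := by
  refine ⟨fun n hn D hD G hG hSE => ⟨?_, ?_, ?_⟩, 3, fun n hn D hD G hG hSE => ?_⟩
  · exact DestructionGame.xor_isTwoConnected_isStar hn hD hG hSE
  · exact DestructionGame.socialCost_of_isTwoConnected hD
  · exact DestructionGame.socialCost_of_isStar hn hD
  · exact DestructionGame.socialCost_le hn hD hG hSE
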